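/- Let $\Sigma$ be a finite alphabet. A word $w$ over $\Sigma$ is a minimal absent word of a string $S$ over $\Sigma$ if $w$ is not a (contiguous) substring of $S$ but every proper substring of $w$ is a substring of $S$; let $\mathsf{MAW}(S)$ be the set of all minimal absent words of $S$. For a string $T = T[1..n]$ of length $n$ over $\Sigma$ and $1 \le d < n$ let $$\mathcal S(T,d) = \sum_{i=1}^{n-d} \bigl|\mathsf{MAW}(T[i..i+d-1]) \mathbin{\triangle} \mathsf{MAW}(T[i+1..i+d])\bigr| ,$$ where $\triangle$ denotes the symmetric difference. (1) Upper bound: there is an absolute constant $C > 0$ such that for every finite alphabet $\Sigma$, every string $T$ of length $n$ over $\Sigma$ and every $1 \le d < n$, $$\mathcal S(T,d) \le C \cdot \min\{\sigma_T, d\} \cdot n ,$$ where $\sigma_T \le |\Sigma|$ is the number of distinct characters of $T$ (so also $\mathcal S(T,d) \le C \min\{|\Sigma|, d\}\, n$). (2) Matching lower bound when $n-d \in \Omega(n)$: for every $\varepsilon > 0$ there is a constant $c > 0$, depending only on $\varepsilon$, such that for every finite alphabet $\Sigma$ of size $\sigma \ge 2$ and all integers $1 \le d < n$ with $n - d \ge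 \varepsilon n$ there is a string $T$ of length $n$ over $\Sigma$, in which all $\sigma$ characters occur if $\sigma \le n$, with $$\mathcal S(T,d) \ge c \cdot \min\{\sigma, d\} \cdot n .$$ -/

import Mathlib

open scoped symmDiff

/-- The set of minimal absent words of a string `S` over the alphabet `α`: the words that do not
occur in `S` while each of their proper substrings does. (`u <:+: w` says that `u` is a contiguous
substring of `w`.) -/
def MAW {α : Type*} (S : List α) : Set (List α) :=
  {w | ¬ w <:+: S ∧ ∀ u : List α, u <:+: w → u ≠ w → u <:+: S}

/-- The window of length `d` of `T` that starts after the first `i` characters. -/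
def window {α : Type*} (T : List α) (i d : ℕ) : List α :=
  (T.drop i).take d

/-- The total number of changes in the set of minimal absent words when a window of length `d`
slides over `T`. The summand with index `i` is the shift from the `(i+1)`-st window to the next. -/
noncomputable def totalMAWChange {α : Type*} (T : List α) (d : ℕ) : ℕ :=
  ∑ i ∈ Finset.range (T.length - d), (MAW (window T i d) ∆ MAW (window T (i + 1) d)).ncard

/-- Over a finite alphabet a string has finitely many minimal absent words, so that the
cardinalities in `totalMAWChange` are genuine. -/
theorem MAW_finite {α : Type*} [Finite α] (S : List α) : (MAW S).Finite := by
  refine (List.finite_length_le α (S.length + 1)).subset ?_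
  rintro w ⟨-, h⟩
  cases w with
  | nil => simp
  | cons a v =>
    have hv : v <:+: S :=
      h v (List.suffix_cons a v).isInfix fun e => by simpa using congrArg List.length e
    simpa using hv.length_le

/-!
Upper bound. A shift appends a character `c` to the window `S` and then deletes the first character;
a deletion is an insertion read backwards (`MAW_reverse`). Appending `c` destroys at most one minimal
absent word. A new one has a maximal proper substring that is a suffix of `S ++ [c]` absent from `S`.
Let `maxRepeat S` be the length of the longest suffix of `S` that also occurs elsewhere in `S`.
* If the tail is old, the word without its last character is the shortest suffix of `S ++ [c]` absent
  from `S`, and only the last character, a character of `S`, is free.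
* If the longest proper prefix is old, the word is `a :: u ++ [c]` with `a` a character of `S` and `u`
  a suffix of `S` with `maxRepeat (S ++ [c]) ≤ |u| ≤ maxRepeat S`.
* If both are new, the word is a power of `c`, and there is at most one such word.

The first and third kinds cost `O(min σ d)` per shift. For the second kind,
`maxRepeat (S ++ [c]) ≤ maxRepeat S + 1`, and deleting the first character does not increase
`maxRepeat`, so that the lengths of the intervals telescope along `T` to at most `n`
(`sum_maxRepeat_window_le`, `sum_maxRepeat_window_reverse_le`).

Lower bound. Suppose that the new window ends in `a :: u`, that `a` occurs only there, and that `u` is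
followed in the window by each of `k` characters `b`. Then all `a :: u ++ [b]` are new minimal absent
words (`card_le_ncard_symmDiff_MAW`). With more than `d` characters, the cyclic string on all of them
satisfies this in every shift with `u` empty and `k = d`. With `4 ≤ σ ≤ d`, fix one character `0` and
put the other `m = σ - 1` at distances `g = ⌊(d + 1) / m⌋` in a period of length `d + 1`, with `0`
elsewhere (`paddedString`). At least half of the shifts have `u = 0 ^ j` with `j < g`, and then nearly
all of the `m` characters, each preceded by `g - 1` zeros, can serve as `b`
(`le_ncard_symmDiff_MAW_padded`). For `σ ≤ 3` a single change per shift suffices; the cyclic string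
provides it, since minimal absent words determine a string of given length.
-/

/-! ### Infixes and the antichain of minimal absent words -/

theorem List.IsInfix.dropLast_or_tail {α : Type*} {u w : List α} (h : u <:+: w) (hne : u ≠ w) :
    u <:+: w.dropLast ∨ u <:+: w.tail := by
  obtain ⟨s, t, rfl⟩ := h
  cases s with
  | nil =>
    have ht : t ≠ [] := by
      rintro rfl
      simp at hne
    left
    rw [List.dropLast_append_of_ne_nil ht]
    exact List.infix_append _ _ _
  | cons x s => exact Or.inr (List.infix_append s u t)

theorem List.eq_replicate_of_cons_eq_concat {α : Type*} {a b : α} {u : List α}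
    (h : a :: u = u ++ [b]) : a :: u = List.replicate (u.length + 1) b := by
  induction u generalizing a with
  | nil => simpa using h
  | cons x u ih =>
    obtain ⟨rfl, h⟩ : a = x ∧ x :: u = u ++ [b] := by simpa using h
    have h' := ih h
    have hab : a = b := by
      rw [List.replicate_succ] at h'
      exact (List.cons.inj h').1
    rw [List.replicate_succ, List.length_cons, ← h', hab]

theorem List.length_dropLast_lt_of_ne_nil {α : Type*} {w : List α} (hw : w ≠ []) :
    w.dropLast.length < w.length := by
  have := List.length_pos_iff.2 hw
  simp only [List.length_dropLast]
  omega

theorem List.length_tail_lt_of_ne_nil {α : Type*} {w : List α} (hw : w ≠ []) :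
    w.tail.length < w.length := by
  have := List.length_pos_iff.2 hw
  simp only [List.length_tail]
  omega

section MAW

variable {α : Type*} {S w w' : List α}

theorem ne_nil_of_mem_MAW (hw : w ∈ MAW S) : w ≠ [] := by
  rintro rfl
  exact hw.1 List.nil_infix

theorem dropLast_infix_of_mem_MAW (hw : w ∈ MAW S) : w.dropLast <:+: S :=
  hw.2 _ (List.dropLast_prefix w).isInfix fun h =>
    (List.length_dropLast_lt_of_ne_nil (ne_nil_of_mem_MAW hw)).ne (congrArg List.length h)

theorem tail_infix_of_mem_MAW (hw : w ∈ MAW S) : w.tail <:+: S :=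
  hw.2 _ (List.tail_suffix w).isInfix fun h =>
    (List.length_tail_lt_of_ne_nil (ne_nil_of_mem_MAW hw)).ne (congrArg List.length h)

/-- Only the two maximal proper substrings of a word matter. -/
theorem mem_MAW_of_dropLast_of_tail (h : ¬ w <:+: S) (hd : w.dropLast <:+: S)
    (ht : w.tail <:+: S) : w ∈ MAW S :=
  ⟨h, fun _ hu hne => (hu.dropLast_or_tail hne).elim (·.trans hd) (·.trans ht)⟩

theorem eq_of_mem_MAW_of_infix (hw : w ∈ MAW S) (hw' : w' ∈ MAW S) (h : w <:+: w') : w = w' := by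
  by_contra hne
  exact hw.1 (hw'.2 w h hne)

theorem reverse_mem_MAW_reverse : w.reverse ∈ MAW S.reverse ↔ w ∈ MAW S := by
  suffices H : ∀ {w S : List α}, w ∈ MAW S → w.reverse ∈ MAW S.reverse by
    refine ⟨fun h => ?_, H⟩
    simpa using H h
  intro w S hw
  refine ⟨fun h => hw.1 (List.reverse_infix.1 h), fun u hu hne => ?_⟩
  have := hw.2 u.reverse (by simpa using List.reverse_infix.2 hu) fun h => hne (by simp [← h])
  simpa using List.reverse_infix.2 this

theorem MAW_reverse : MAW S.reverse = List.reverse '' MAW S := by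
  ext w
  constructor
  · intro h
    exact ⟨w.reverse, reverse_mem_MAW_reverse.1 (by simpa using h), by simp⟩
  · rintro ⟨v, hv, rfl⟩
    exact reverse_mem_MAW_reverse.2 hv

end MAW

/-! ### The longest repeated suffix -/

open Classical in
/-- The length of the longest suffix of `S` that has an occurrence in `S` other than as a suffix,
that is, an occurrence in `S.dropLast`. -/
noncomputable def maxRepeat {α : Type*} (S : List α) : ℕ :=
  Nat.findGreatest (fun l => S.drop (S.length - l) <:+: S.dropLast) S.length

section maxRepeat

variable {α : Type*} {S S' u : List α}

theorem maxRepeat_le_length : maxRepeat S ≤ S.length := by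
  classical
  exact Nat.findGreatest_le _

theorem length_le_maxRepeat (h : u <:+ S) (h' : u <:+: S.dropLast) : u.length ≤ maxRepeat S := by
  classical
  refine Nat.le_findGreatest h.length_le ?_
  rwa [← List.suffix_iff_eq_drop.1 h]

theorem drop_maxRepeat_infix : S.drop (S.length - maxRepeat S) <:+: S.dropLast := by
  classical
  exact Nat.findGreatest_spec (P := fun l => S.drop (S.length - l) <:+: S.dropLast)
    (Nat.zero_le _) (by simp)

theorem infix_dropLast_iff_length_le (h : u <:+ S) :
    u <:+: S.dropLast ↔ u.length ≤ maxRepeat S := by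
  refine ⟨length_le_maxRepeat h, fun hl => ?_⟩
  refine List.IsInfix.trans (List.IsSuffix.isInfix ?_) (drop_maxRepeat_infix (S := S))
  refine List.suffix_of_suffix_length_le h (List.drop_suffix _ _) ?_
  have := maxRepeat_le_length (S := S)
  simp only [List.length_drop]
  omega

theorem List.IsSuffix.dropLast {α : Type*} {S S' : List α} (h : S' <:+ S) :
    S'.dropLast <:+ S.dropLast := by
  obtain ⟨t, rfl⟩ := h
  by_cases hS : S' = []
  · subst hS
    simp
  · rw [List.dropLast_append_of_ne_nil hS]
    exact List.suffix_append _ _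

theorem maxRepeat_mono (h : S' <:+ S) : maxRepeat S' ≤ maxRepeat S := by
  have hs : S'.drop (S'.length - maxRepeat S') <:+ S' := List.drop_suffix _ _
  have hl := length_le_maxRepeat (hs.trans h) (drop_maxRepeat_infix.trans h.dropLast.isInfix)
  have := maxRepeat_le_length (S := S')
  simp only [List.length_drop] at hl
  omega

/-- Appending one character lengthens the longest repeated suffix by at most one. -/
theorem maxRepeat_concat_le (c : α) : maxRepeat (S ++ [c]) ≤ maxRepeat S + 1 := by
  have hs := List.drop_suffix ((S ++ [c]).length - maxRepeat (S ++ [c])) (S ++ [c])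
  have hi := drop_maxRepeat_infix (S := S ++ [c])
  have hl : ((S ++ [c]).drop ((S ++ [c]).length - maxRepeat (S ++ [c]))).length
      = maxRepeat (S ++ [c]) := by
    have := maxRepeat_le_length (S := S ++ [c])
    simp only [List.length_drop]
    omega
  generalize (S ++ [c]).drop ((S ++ [c]).length - maxRepeat (S ++ [c])) = v at hs hi hl
  rw [← hl]
  rcases List.suffix_concat_iff.1 hs with rfl | ⟨t, rfl, ht⟩
  · simp
  · rw [List.dropLast_concat] at hi
    have := length_le_maxRepeat ht (by
      obtain ⟨x, y, hxy⟩ := hi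
      refine ⟨x, ([c] ++ y).dropLast, ?_⟩
      rw [← hxy, ← List.dropLast_append_of_ne_nil (by simp)]
      simp)
    simpa using this

end maxRepeat

/-! ### Appending or prepending one character -/

section Append

variable {α : Type*} {S w : List α} {c : α}

theorem suffix_of_infix_concat_of_not_infix {u : List α} (h : u <:+: S ++ [c]) (hS : ¬ u <:+: S) :
    u <:+ S ++ [c] :=
  (List.infix_concat_iff.1 h).resolve_right hS

/-- A character can destroy at most one minimal absent word, the shortest suffix of `S ++ [c]` that
is absent from `S`. -/
theorem subsingleton_MAW_diff_MAW_concat : (MAW S \ MAW (S ++ [c])).Subsingleton := by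
  have key : ∀ w ∈ MAW S \ MAW (S ++ [c]), w <:+ S ++ [c] := by
    rintro w ⟨hw, hw'⟩
    have hinf : w <:+: S ++ [c] := by
      by_contra h
      exact hw' ⟨h, fun u hu hne => (hw.2 u hu hne).trans (List.prefix_append S [c]).isInfix⟩
    exact suffix_of_infix_concat_of_not_infix hinf hw.1
  intro w hw w' hw'
  rcases List.suffix_or_suffix_of_suffix (key w hw) (key w' hw') with h | h
  · exact eq_of_mem_MAW_of_infix hw.1 hw'.1 h.isInfix
  · exact (eq_of_mem_MAW_of_infix hw'.1 hw.1 h.isInfix).symm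

theorem subsingleton_MAW_replicate (c : α) :
    {w ∈ MAW S | w = List.replicate w.length c}.Subsingleton := by
  have key : ∀ w w' : List α, w = List.replicate w.length c → w' = List.replicate w'.length c →
      w.length ≤ w'.length → w <:+: w' := by
    intro w w' h h' hl
    rw [h, h']
    refine ⟨[], List.replicate (w'.length - w.length) c, ?_⟩
    rw [List.nil_append, List.replicate_append_replicate, Nat.add_sub_cancel' hl]
  rintro w ⟨hw, hr⟩ w' ⟨hw', hr'⟩
  rcases le_total w.length w'.length with h | h
  · exact eq_of_mem_MAW_of_infix hw hw' (key _ _ hr hr' h)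
  · exact (eq_of_mem_MAW_of_infix hw' hw (key _ _ hr' hr h)).symm

/-- A new minimal absent word whose tail was already present is the shortest suffix of `S ++ [c]`
that is absent from `S`, extended by one character of `S`. -/
theorem mem_image_of_tail_infix [DecidableEq α] (hw : w ∈ MAW (S ++ [c]))
    (hd : ¬ w.dropLast <:+: S) (ht : w.tail <:+: S) :
    w ∈ S.toFinset.image fun b =>
      (S ++ [c]).drop ((S ++ [c]).length - (maxRepeat (S ++ [c]) + 1)) ++ [b] := by
  obtain ⟨v, b, rfl⟩ := List.eq_nil_or_concat' w |>.resolve_left (ne_nil_of_mem_MAW hw)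
  rw [List.dropLast_concat] at hd
  cases v with
  | nil => exact absurd List.nil_infix hd
  | cons a u =>
    have hvs : a :: u <:+ S ++ [c] :=
      suffix_of_infix_concat_of_not_infix (by
        have := dropLast_infix_of_mem_MAW hw
        rwa [List.dropLast_concat] at this) hd
    rw [List.cons_append, List.tail_cons] at ht
    have hu : u <:+: S := (List.prefix_append u [b]).isInfix.trans ht
    have h1 := length_le_maxRepeat ((List.suffix_cons a u).trans hvs) (by simpa using hu)
    have h2 : ¬ (a :: u).length ≤ maxRepeat (S ++ [c]) := fun h =>
      hd (by simpa using (infix_dropLast_iff_length_le hvs).2 h)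
    have hlen : (a :: u).length = maxRepeat (S ++ [c]) + 1 := by
      simp only [List.length_cons] at h2 ⊢
      omega
    refine Finset.mem_image.2 ⟨b, List.mem_toFinset.2 (ht.subset (by simp)), ?_⟩
    rw [← hlen, ← List.suffix_iff_eq_drop.1 hvs]

/-- A new minimal absent word whose longest proper prefix was already present is `a :: u ++ [c]`
with `u` a suffix of `S`; that `u` is repeated in `S` while `u ++ [c]` is new confines its length to
an interval between the two values of `maxRepeat`. -/
theorem mem_image_of_dropLast_infix [DecidableEq α] (hw : w ∈ MAW (S ++ [c]))
    (hd : w.dropLast <:+: S) (ht : ¬ w.tail <:+: S) :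
    w ∈ (S.toFinset ×ˢ Finset.Ico (maxRepeat (S ++ [c])) (maxRepeat S + 1)).image fun p =>
      p.1 :: (S.drop (S.length - p.2) ++ [c]) := by
  cases w with
  | nil => exact absurd List.nil_infix ht
  | cons a v =>
    rw [List.tail_cons] at ht
    obtain ⟨u, b, rfl⟩ := List.eq_nil_or_concat' v |>.resolve_left (by
      rintro rfl
      exact ht List.nil_infix)
    rw [← List.cons_append, List.dropLast_concat] at hd
    have hvs : u ++ [b] <:+ S ++ [c] :=
      suffix_of_infix_concat_of_not_infix (by simpa using tail_infix_of_mem_MAW hw) ht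
    obtain ⟨hu, rfl⟩ : u <:+ S ∧ b = c := by
      rcases List.suffix_concat_iff.1 hvs with h | ⟨t, h, h'⟩
      · simp at h
      · obtain ⟨rfl, h⟩ := List.append_inj' h rfl
        exact ⟨h', by simpa using h⟩
    have h1 : ¬ (u ++ [b]).length ≤ maxRepeat (S ++ [b]) := fun h =>
      ht (by simpa using (infix_dropLast_iff_length_le hvs).2 h)
    have hns : ¬ a :: u <:+ S := by
      rintro ⟨x, rfl⟩
      exact hw.1 ⟨x, [], by simp⟩
    have h2 : u <:+: S.dropLast := by
      obtain ⟨x, y, rfl⟩ := hd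
      have hy : y ≠ [] := by
        rintro rfl
        exact hns ⟨x, by simp⟩
      rw [List.dropLast_append_of_ne_nil hy]
      exact ⟨x ++ [a], y.dropLast, by simp⟩
    have h3 := length_le_maxRepeat hu h2
    refine Finset.mem_image.2 ⟨(a, u.length), ?_, ?_⟩
    · simp only [Finset.mem_product, List.mem_toFinset, Finset.mem_Ico]
      refine ⟨hd.subset (by simp), ?_⟩
      simp only [List.length_append, List.length_singleton] at h1
      omega
    · rw [← List.suffix_iff_eq_drop.1 hu]

/-- A new minimal absent word whose two maximal proper substrings are both new is a power of the
appended character, since these substrings are suffixes of `S ++ [c]` of equal length. -/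
theorem eq_replicate_of_not_infix (hw : w ∈ MAW (S ++ [c]))
    (hd : ¬ w.dropLast <:+: S) (ht : ¬ w.tail <:+: S) : w = List.replicate w.length c := by
  have hds := suffix_of_infix_concat_of_not_infix (dropLast_infix_of_mem_MAW hw) hd
  have hts := suffix_of_infix_concat_of_not_infix (tail_infix_of_mem_MAW hw) ht
  have heq : w.dropLast = w.tail := by
    rw [List.suffix_iff_eq_drop.1 hds, List.suffix_iff_eq_drop.1 hts]
    simp
  cases w with
  | nil => rfl
  | cons a v =>
    rw [List.tail_cons] at heq ht hts
    obtain ⟨u, b, rfl⟩ := List.eq_nil_or_concat' v |>.resolve_left (by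
      rintro rfl
      exact ht List.nil_infix)
    rw [← List.cons_append, List.dropLast_concat] at heq
    obtain rfl : b = c := by
      rcases List.suffix_concat_iff.1 hts with h | ⟨t, h, -⟩
      · simp at h
      · simpa using (List.append_inj' h rfl).2
    rw [← List.cons_append, heq, List.append_assoc, ← List.append_assoc, ← heq,
      List.eq_replicate_of_cons_eq_concat heq]
    simp [← List.replicate_succ']

variable [Finite α] [DecidableEq α]

theorem ncard_symmDiff_MAW_concat_le (S : List α) (c : α) :
    (MAW S ∆ MAW (S ++ [c])).ncard ≤
      (maxRepeat S + 1 - maxRepeat (S ++ [c])) * S.toFinset.card + S.toFinset.card + 2 := by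
  set A := S.toFinset.image fun b =>
      (S ++ [c]).drop ((S ++ [c]).length - (maxRepeat (S ++ [c]) + 1)) ++ [b]
  set B := (S.toFinset ×ˢ Finset.Ico (maxRepeat (S ++ [c])) (maxRepeat S + 1)).image fun p =>
      p.1 :: (S.drop (S.length - p.2) ++ [c])
  have hA : A.card ≤ S.toFinset.card := Finset.card_image_le
  have hB : B.card ≤ (maxRepeat S + 1 - maxRepeat (S ++ [c])) * S.toFinset.card := by
    refine Finset.card_image_le.trans ?_
    rw [Finset.card_product, Nat.card_Ico, mul_comm]
  set R := {w ∈ MAW (S ++ [c]) | w = List.replicate w.length c}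
  have hR : R.ncard ≤ 1 :=
    (Set.ncard_le_one ((MAW_finite _).subset fun _ h => h.1)).2 fun _ h _ h' =>
      subsingleton_MAW_replicate c h h'
  have hD : (MAW S \ MAW (S ++ [c])).ncard ≤ 1 :=
    (Set.ncard_le_one ((MAW_finite _).subset Set.sdiff_subset)).2 fun _ h _ h' =>
      subsingleton_MAW_diff_MAW_concat h h'
  have hsub : MAW S ∆ MAW (S ++ [c]) ⊆
      (MAW S \ MAW (S ++ [c])) ∪ ((A : Set (List α)) ∪ (B ∪ R)) := by
    rintro w (hw | ⟨hw, hw'⟩)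
    · exact Or.inl hw
    · right
      by_cases hd : w.dropLast <:+: S <;> by_cases ht : w.tail <:+: S
      · refine absurd (mem_MAW_of_dropLast_of_tail (fun h => hw.1 ?_) hd ht) hw'
        exact h.trans (List.prefix_append S [c]).isInfix
      · exact Or.inr (Or.inl (mem_image_of_dropLast_infix hw hd ht))
      · exact Or.inl (mem_image_of_tail_infix hw hd ht)
      · exact Or.inr (Or.inr ⟨hw, eq_replicate_of_not_infix hw hd ht⟩)
  have hfin : ((MAW S \ MAW (S ++ [c])) ∪ ((A : Set (List α)) ∪ (B ∪ R))).Finite :=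
    ((MAW_finite _).subset Set.sdiff_subset).union (A.finite_toSet.union
      (B.finite_toSet.union ((MAW_finite _).subset fun _ h => h.1)))
  have h1 := Set.ncard_le_ncard hsub hfin
  have h2 := Set.ncard_union_le (MAW S \ MAW (S ++ [c])) ((A : Set (List α)) ∪ (B ∪ R))
  have h3 := Set.ncard_union_le (A : Set (List α)) (B ∪ R)
  have h4 := Set.ncard_union_le (B : Set (List α)) R
  rw [Set.ncard_coe_finset] at h3 h4
  omega

theorem ncard_symmDiff_MAW_cons_le (S : List α) (c : α) :
    (MAW S ∆ MAW (c :: S)).ncard ≤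
      (maxRepeat S.reverse + 1 - maxRepeat (c :: S).reverse) * S.toFinset.card
        + S.toFinset.card + 2 := by
  have h := ncard_symmDiff_MAW_concat_le S.reverse c
  rw [← List.reverse_cons, MAW_reverse, MAW_reverse,
    ← Set.image_symmDiff List.reverse_injective,
    Set.ncard_image_of_injective _ List.reverse_injective, List.toFinset_reverse] at h
  exact h

end Append

/-! ### The upper bound -/

section Window

variable {α : Type*} (T : List α) {i d : ℕ}

theorem length_window (h : i + d ≤ T.length) : (window T i d).length = d := by
  simp only [window, List.length_take, List.length_drop]
  omega

theorem window_succ_eq_concat (h : i + d < T.length) :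
    window T i (d + 1) = window T i d ++ [T[i + d]] := by
  rw [window, window, List.take_add_one, List.getElem?_drop, List.getElem?_eq_getElem h]
  rfl

theorem window_succ_eq_cons (h : i < T.length) :
    window T i (d + 1) = T[i] :: window T (i + 1) d := by
  rw [window, window, List.drop_eq_getElem_cons h, List.take_succ_cons]

theorem card_toFinset_window_le [DecidableEq α] (i d : ℕ) :
    (window T i d).toFinset.card ≤ min T.toFinset.card d := by
  refine le_min (Finset.card_le_card fun a ha => ?_) ?_
  · rw [List.mem_toFinset] at ha ⊢
    exact List.mem_of_mem_drop (List.mem_of_mem_take ha)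
  · exact (List.toFinset_card_le _).trans (by simp [window])

theorem one_le_min_card_toFinset [DecidableEq α] (hd : 1 ≤ d) (hT : d < T.length) :
    1 ≤ min T.toFinset.card d := by
  refine le_min (Finset.card_pos.2 ⟨T[0], ?_⟩) hd
  exact List.mem_toFinset.2 (List.getElem_mem _)

theorem sum_maxRepeat_window_le {k : ℕ} (h : k + d ≤ T.length) :
    ∑ i ∈ Finset.range k, (maxRepeat (window T i d) + 1 - maxRepeat (window T i (d + 1))) +
      maxRepeat (window T k d) ≤ maxRepeat (window T 0 d) + k := by
  induction k with
  | zero => simp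
  | succ k ih =>
    have ih := ih (by omega)
    rw [Finset.sum_range_succ]
    have h1 : maxRepeat (window T k (d + 1)) ≤ maxRepeat (window T k d) + 1 := by
      rw [window_succ_eq_concat T (by omega)]
      exact maxRepeat_concat_le _
    have h2 : maxRepeat (window T (k + 1) d) ≤ maxRepeat (window T k (d + 1)) := by
      rw [window_succ_eq_cons T (by omega)]
      exact maxRepeat_mono (List.suffix_cons _ _)
    omega

theorem sum_maxRepeat_window_reverse_le {k : ℕ} (h : k + d ≤ T.length) :
    ∑ i ∈ Finset.range k,
        (maxRepeat (window T (i + 1) d).reverse + 1 - maxRepeat (window T i (d + 1)).reverse) +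
      maxRepeat (window T 0 d).reverse ≤ maxRepeat (window T k d).reverse + k := by
  induction k with
  | zero => simp
  | succ k ih =>
    have ih := ih (by omega)
    rw [Finset.sum_range_succ]
    have h1 : maxRepeat (window T k (d + 1)).reverse ≤
        maxRepeat (window T (k + 1) d).reverse + 1 := by
      rw [window_succ_eq_cons T (by omega), List.reverse_cons]
      exact maxRepeat_concat_le _
    have h2 : maxRepeat (window T k d).reverse ≤ maxRepeat (window T k (d + 1)).reverse := by
      rw [window_succ_eq_concat T (by omega), List.reverse_append]
      exact maxRepeat_mono (List.suffix_append _ _)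
    omega

variable [Finite α] [DecidableEq α]

/-- One shift, as an append followed by a removal at the front; the two truncated differences are
the amortized part of the cost. -/
theorem ncard_symmDiff_MAW_window_le (h : i + d < T.length) :
    (MAW (window T i d) ∆ MAW (window T (i + 1) d)).ncard ≤
      ((maxRepeat (window T i d) + 1 - maxRepeat (window T i (d + 1))) +
        (maxRepeat (window T (i + 1) d).reverse + 1 - maxRepeat (window T i (d + 1)).reverse)) *
          min T.toFinset.card d + 2 * min T.toFinset.card d + 4 := by
  have h1 := ncard_symmDiff_MAW_concat_le (window T i d) T[i + d]
  have h2 := ncard_symmDiff_MAW_cons_le (window T (i + 1) d) T[i]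
  rw [← window_succ_eq_concat T h] at h1
  rw [← window_succ_eq_cons T (by omega)] at h2
  have h3 : (MAW (window T i d) ∆ MAW (window T (i + 1) d)).ncard ≤
      (MAW (window T i d) ∆ MAW (window T i (d + 1))).ncard +
        (MAW (window T (i + 1) d) ∆ MAW (window T i (d + 1))).ncard := by
    refine (Set.ncard_le_ncard (symmDiff_triangle _ (MAW (window T i (d + 1))) _) ?_).trans ?_
    · exact ((MAW_finite _).symmDiff (MAW_finite _)).union
        ((MAW_finite _).symmDiff (MAW_finite _))
    · rw [symmDiff_comm (MAW (window T (i + 1) d))]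
      exact Set.ncard_union_le _ _
  have h4 := Nat.mul_le_mul_left
    (maxRepeat (window T i d) + 1 - maxRepeat (window T i (d + 1)))
    (card_toFinset_window_le T i d)
  have h5 := Nat.mul_le_mul_left
    (maxRepeat (window T (i + 1) d).reverse + 1 - maxRepeat (window T i (d + 1)).reverse)
    (card_toFinset_window_le T (i + 1) d)
  have h6 := card_toFinset_window_le T i d
  have h7 := card_toFinset_window_le T (i + 1) d
  rw [add_mul]
  omega

theorem totalMAWChange_le (hd : 1 ≤ d) (hT : d < T.length) :
    totalMAWChange T d ≤ 8 * min T.toFinset.card d * T.length := by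
  have hm := one_le_min_card_toFinset T hd hT
  have hsum := Finset.sum_le_sum fun i (hi : i ∈ Finset.range (T.length - d)) =>
    ncard_symmDiff_MAW_window_le T (i := i) (d := d) (by
      have := Finset.mem_range.1 hi
      omega)
  refine hsum.trans ?_
  generalize min T.toFinset.card d = m at hm ⊢
  simp only [Finset.sum_add_distrib, ← Finset.sum_mul, Finset.sum_const, Finset.card_range,
    smul_eq_mul]
  have h1 := sum_maxRepeat_window_le T (d := d) (k := T.length - d) (by omega)
  have h2 := sum_maxRepeat_window_reverse_le T (d := d) (k := T.length - d) (by omega)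
  have h3 := maxRepeat_le_length (S := window T 0 d)
  have h4 := maxRepeat_le_length (S := (window T (T.length - d) d).reverse)
  rw [length_window T (by omega)] at h3
  rw [List.length_reverse, length_window T (by omega)] at h4
  have h5 := Nat.mul_le_mul_right m (show _ ≤ 2 * T.length from
    (add_le_add (Nat.le_of_add_right_le h1) (Nat.le_of_add_right_le h2)).trans (by omega))
  have h6 : (T.length - d) * (2 * m) + (T.length - d) * 4 ≤ 6 * m * T.length := by
    have := Nat.mul_le_mul (Nat.sub_le T.length d) (show 2 * m + 4 ≤ 6 * m by omega)
    linarith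
  linarith

end Window

/-! ### Lower bounds for a single shift -/

theorem exists_mem_MAW_infix {α : Type*} {S w : List α} (h : ¬ w <:+: S) :
    ∃ u ∈ MAW S, u <:+: w := by
  induction hn : w.length using Nat.strong_induction_on generalizing w with
  | _ n ih =>
    subst hn
    have hw : w ≠ [] := by
      rintro rfl
      exact h List.nil_infix
    by_cases hd : w.dropLast <:+: S
    · by_cases ht : w.tail <:+: S
      · exact ⟨w, mem_MAW_of_dropLast_of_tail h hd ht, List.infix_refl w⟩
      · obtain ⟨u, hu, hi⟩ := ih _ (List.length_tail_lt_of_ne_nil hw) ht rfl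
        exact ⟨u, hu, hi.trans (List.tail_suffix w).isInfix⟩
    · obtain ⟨u, hu, hi⟩ := ih _ (List.length_dropLast_lt_of_ne_nil hw) hd rfl
      exact ⟨u, hu, hi.trans (List.dropLast_prefix w).isInfix⟩

/-- Strings of equal length are determined by their minimal absent words: if `S ≠ S'`, then `S` is
absent from `S'` and so contains a minimal absent word of `S'`. -/
theorem one_le_ncard_symmDiff_MAW {α : Type*} [Finite α] {S S' : List α}
    (hl : S.length = S'.length) (hne : S ≠ S') : 1 ≤ (MAW S ∆ MAW S').ncard := by
  obtain ⟨u, hu, hi⟩ := exists_mem_MAW_infix (S := S') (w := S) fun h => hne (h.eq_of_length hl)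
  refine (Set.ncard_pos ((MAW_finite S).symmDiff (MAW_finite S'))).2 ⟨u, Or.inr ⟨hu, ?_⟩⟩
  exact fun h => h.1 hi

/-- The factor of length `k`, starting at position `i`, of the infinite string `F`. -/
def factor {α : Type*} (F : ℕ → α) (i k : ℕ) : List α :=
  (List.range' i k).map F

section factor

variable {α : Type*} {F : ℕ → α} {i i' k k' d : ℕ}

@[simp]
theorem length_factor : (factor F i k).length = k := by
  simp [factor]

theorem factor_add : factor F i (k + k') = factor F i k ++ factor F (i + k) k' := by
  rw [factor, factor, factor, ← List.map_append, List.range'_append_1]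

theorem factor_succ_eq_cons : factor F i (k + 1) = F i :: factor F (i + 1) k := by
  simp [factor, List.range'_succ]

theorem factor_succ_eq_concat : factor F i (k + 1) = factor F i k ++ [F (i + k)] := by
  rw [factor_add]
  rfl

theorem factor_infix (h : i' ≤ i) (h' : i + k ≤ i' + k') : factor F i k <:+: factor F i' k' := by
  obtain ⟨x, rfl⟩ := Nat.exists_eq_add_of_le h
  obtain ⟨y, rfl⟩ : ∃ y, k' = x + k + y := ⟨k' - x - k, by omega⟩
  rw [factor_add, factor_add]
  exact List.infix_append _ _ _

theorem exists_eq_of_infix_factor {v : List α} (h : v <:+: factor F i k) :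
    ∃ s, i ≤ s ∧ s + v.length ≤ i + k ∧ v = factor F s v.length := by
  obtain ⟨x, y, h⟩ := h
  have hl : x.length + v.length + y.length = k := by
    simpa [add_assoc] using congrArg List.length h
  refine ⟨i + x.length, by omega, by omega, ?_⟩
  rw [← hl, factor_add, factor_add] at h
  have h1 := (List.append_inj h (by simp)).1
  exact (List.append_inj h1 (by simp)).2

theorem factor_eq_replicate {a : α} (h : ∀ r < k, F (i + r) = a) :
    factor F i k = List.replicate k a := by
  refine List.eq_replicate_iff.2 ⟨length_factor, fun b hb => ?_⟩
  simp only [factor, List.mem_map, List.mem_range'_1] at hb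
  obtain ⟨s, ⟨h1, h2⟩, rfl⟩ := hb
  obtain ⟨r, rfl⟩ := Nat.exists_eq_add_of_le h1
  exact h r (by omega)

theorem window_map_range {n : ℕ} (h : i + d ≤ n) :
    window ((List.range n).map F) i d = factor F i d := by
  rw [window, ← List.map_drop, ← List.map_take, factor]
  congr 1
  refine List.ext_getElem ?_ fun r h1 h2 => ?_
  · simp only [List.length_take, List.length_drop, List.length_range, List.length_range']
    omega
  · simp

/-- Let the new window `factor F (i + 1) d` end in `a :: u`, where `a = F q`, and let `a` occur
nowhere else in the two windows. Then for every character `b` for which `u ++ [b]` occurs in the new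
window, `a :: u ++ [b]` is a minimal absent word of the new window; it is none of the old one, from
which `a :: u` is absent. -/
theorem card_le_ncard_symmDiff_MAW [Finite α] {q j : ℕ} (hq : q + j = i + d) (hi : i < q)
    (huniq : ∀ s, i ≤ s → s ≤ i + d → F s = F q → s = q) (B : Finset α)
    (hB : ∀ b ∈ B, ∃ s, i < s ∧ s + j ≤ i + d ∧
      factor F s j = factor F (q + 1) j ∧ F (s + j) = b) :
    B.card ≤ (MAW (factor F i d) ∆ MAW (factor F (i + 1) d)).ncard := by
  have hinj : Function.Injective fun b : α => factor F q (j + 1) ++ [b] := by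
    intro b b' h
    simpa using h
  rw [← Set.ncard_coe_finset, ← Set.ncard_image_of_injective (B : Set α) hinj]
  refine Set.ncard_le_ncard ?_ ((MAW_finite _).symmDiff (MAW_finite _))
  rintro _ ⟨b, hb, rfl⟩
  obtain ⟨s, hs, hsj, hfac, rfl⟩ := hB b hb
  refine Or.inr ⟨mem_MAW_of_dropLast_of_tail ?_ ?_ ?_, ?_⟩
  · intro h
    obtain ⟨t, ht, ht', heq⟩ := exists_eq_of_infix_factor h
    simp only [List.length_append, length_factor, List.length_singleton] at ht' heq
    rw [factor_succ_eq_cons, factor_succ_eq_cons] at heq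
    have := huniq t (by omega) (by omega) (List.cons.inj heq).1.symm
    omega
  · rw [List.dropLast_concat]
    exact factor_infix (by omega) (by omega)
  · beta_reduce
    rw [factor_succ_eq_cons, List.cons_append, List.tail_cons, ← hfac, ← factor_succ_eq_concat]
    exact factor_infix (by omega) (by omega)
  · intro h
    have h := dropLast_infix_of_mem_MAW h
    rw [List.dropLast_concat] at h
    obtain ⟨t, ht, ht', heq⟩ := exists_eq_of_infix_factor h
    rw [length_factor] at ht' heq
    rw [factor_succ_eq_cons, factor_succ_eq_cons] at heq
    have := huniq t (by omega) (by omega) (List.cons.inj heq).1.symm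
    omega

end factor

theorem totalMAWChange_map_range {α : Type*} (F : ℕ → α) (n d : ℕ) :
    totalMAWChange ((List.range n).map F) d =
      ∑ i ∈ Finset.range (n - d), (MAW (factor F i d) ∆ MAW (factor F (i + 1) d)).ncard := by
  rw [totalMAWChange, List.length_map, List.length_range]
  refine Finset.sum_congr rfl fun i hi => ?_
  have := Finset.mem_range.1 hi
  rw [window_map_range (by omega), window_map_range (by omega)]

theorem toFinset_map_range_eq_univ {α : Type*} [Fintype α] [DecidableEq α] {F : ℕ → α} {n : ℕ}
    (h : ∀ a, ∃ t < n, F t = a) : ((List.range n).map F).toFinset = Finset.univ := by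
  refine Finset.eq_univ_iff_forall.2 fun a => ?_
  obtain ⟨t, ht, rfl⟩ := h a
  simpa using ⟨t, ht, rfl⟩

theorem Nat.eq_of_mod_eq_of_lt_add {P s t : ℕ} (h : s % P = t % P) (h1 : s < t + P)
    (h2 : t < s + P) : s = t := by
  rcases le_total s t with hl | hl
  · have := Nat.eq_zero_of_dvd_of_lt ((Nat.modEq_iff_dvd' hl).1 h) (by omega)
    omega
  · have := Nat.eq_zero_of_dvd_of_lt ((Nat.modEq_iff_dvd' hl).1 h.symm) (by omega)
    omega

/-! ### The cyclic string on all characters -/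

section cyclic

variable {α : Type*} [Fintype α] {y : ℕ → α} {d : ℕ}

theorem le_ncard_symmDiff_MAW_cyclic {p : ℕ} (hy : Set.InjOn y (Set.Iio p)) (hd : 1 ≤ d)
    (hdp : d < p) (i : ℕ) :
    d ≤ (MAW (factor (fun t => y (t % p)) i d) ∆
      MAW (factor (fun t => y (t % p)) (i + 1) d)).ncard := by
  classical
  have hF : ∀ s t, y (s % p) = y (t % p) → s % p = t % p := fun s t h =>
    hy (Nat.mod_lt _ (by omega)) (Nat.mod_lt _ (by omega)) h
  have hcard : ((Finset.Ioc i (i + d)).image fun t => y (t % p)).card = d := by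
    rw [Finset.card_image_of_injOn, Nat.card_Ioc, Nat.add_sub_cancel_left]
    intro s hs t ht h
    simp only [Finset.coe_Ioc, Set.mem_Ioc] at hs ht
    exact Nat.eq_of_mod_eq_of_lt_add (hF s t h) (by omega) (by omega)
  refine hcard.symm.le.trans (card_le_ncard_symmDiff_MAW (F := fun t => y (t % p))
    (i := i) (d := d) (q := i + d) (j := 0) rfl (by omega) ?_ _ ?_)
  · intro s h1 h2 h
    exact Nat.eq_of_mod_eq_of_lt_add (hF s (i + d) h) (by omega) (by omega)
  · intro b hb
    obtain ⟨s, hs, rfl⟩ := Finset.mem_image.1 hb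
    rw [Finset.mem_Ioc] at hs
    exact ⟨s, hs.1, hs.2, rfl, rfl⟩

theorem one_le_ncard_symmDiff_MAW_cyclic {p : ℕ} (hy : Set.InjOn y (Set.Iio p)) (hd : 1 ≤ d)
    (hp : 2 ≤ p) (i : ℕ) :
    1 ≤ (MAW (factor (fun t => y (t % p)) i d) ∆
      MAW (factor (fun t => y (t % p)) (i + 1) d)).ncard := by
  refine one_le_ncard_symmDiff_MAW (by simp) fun h => ?_
  obtain ⟨d, rfl⟩ := Nat.exists_eq_add_of_le' hd
  rw [factor_succ_eq_cons, factor_succ_eq_cons] at h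
  have := Nat.eq_of_mod_eq_of_lt_add
    (hy (Nat.mod_lt _ (by omega)) (Nat.mod_lt _ (by omega)) (List.cons.inj h).1)
    (by omega) (by omega)
  omega

end cyclic

/-! ### A string of period `d + 1` with padded characters -/

/-- The infinite string of period `d + 1` in which `y 1, …, y m` stand at the positions `t` of phase
`(t + 1) % (d + 1) = 0, g, …, (m - 1) * g`, all other places being filled with `y 0`. With this
definition of the phase, the last position `i + d` of the window that starts at `i + 1` has phase
`i % (d + 1)`. -/
def paddedString {α : Type*} (y : ℕ → α) (d g m t : ℕ) : α :=
  if g ∣ (t + 1) % (d + 1) ∧ (t + 1) % (d + 1) / g < m then y ((t + 1) % (d + 1) / g + 1) else y 0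

section padded

variable {α : Type*} {y : ℕ → α} {d g m : ℕ}

theorem paddedString_eq {t e k : ℕ} (hg : 0 < g) (hk : k < m) (hkd : g * k < d + 1)
    (ht : t + 1 = (d + 1) * e + g * k) : paddedString y d g m t = y (k + 1) := by
  have h : (t + 1) % (d + 1) = g * k := by
    rw [ht, Nat.mul_add_mod, Nat.mod_eq_of_lt hkd]
  rw [paddedString, h, Nat.mul_div_cancel_left _ hg, if_pos ⟨Nat.dvd_mul_right _ _, hk⟩]

theorem paddedString_eq_zero {t e k r : ℕ} (hr : 0 < r) (hrg : r < g) (hkd : g * k + r < d + 1)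
    (ht : t + 1 = (d + 1) * e + (g * k + r)) : paddedString y d g m t = y 0 := by
  have h : (t + 1) % (d + 1) = g * k + r := by
    rw [ht, Nat.mul_add_mod, Nat.mod_eq_of_lt hkd]
  rw [paddedString, h, if_neg]
  rintro ⟨h, -⟩
  exact Nat.not_dvd_of_pos_of_lt hr hrg ((Nat.dvd_add_right (Nat.dvd_mul_right g k)).1 h)

theorem mod_eq_of_paddedString_eq (hy : Set.InjOn y (Set.Iio (m + 1))) {t k : ℕ} (hk : k < m)
    (h : paddedString y d g m t = y (k + 1)) : (t + 1) % (d + 1) = g * k := by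
  rw [paddedString] at h
  split_ifs at h with hc
  · have := hy (by simpa using hc.2) (by simpa using hk) h
    rw [← Nat.succ_injective this, Nat.mul_div_cancel' hc.1]
  · have := hy (by simp) (by simpa using hk) h
    omega

/-- In the phases below `m * g` the new window ends in `y (k₀ + 1)` followed by fewer than `g`
copies of `y 0`. All the other `y (k + 1)` with `1 ≤ k` are preceded by enough copies of `y 0` in the window,
except the one whose padding is cut by the window boundary. -/
theorem le_ncard_symmDiff_MAW_padded [Finite α] (hy : Set.InjOn y (Set.Iio (m + 1))) (hg : 0 < g)
    (hm : 2 ≤ m) (hd : 1 ≤ d) (hmg : m * g ≤ d + 1) {i : ℕ} (hi : i % (d + 1) < m * g) :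
    m - 2 ≤ (MAW (factor (paddedString y d g m) i d) ∆
      MAW (factor (paddedString y d g m) (i + 1) d)).ncard := by
  classical
  have hi' := Nat.div_add_mod i (d + 1)
  generalize i % (d + 1) = φ at hi hi'
  generalize i / (d + 1) = e at hi'
  have hφ := Nat.div_add_mod φ g
  have hj : φ % g < g := Nat.mod_lt _ hg
  have hk₀ : φ / g < m := Nat.div_lt_of_lt_mul (by rwa [mul_comm])
  generalize φ % g = j at hφ hj
  generalize φ / g = k₀ at hφ hk₀
  have h2g : 2 * g ≤ m * g := Nat.mul_le_mul_right g hm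
  have he : (d + 1) * (e + 1) = (d + 1) * e + (d + 1) := Nat.mul_succ _ _
  obtain ⟨q, hq⟩ : ∃ q, q + j = i + d := ⟨i + d - j, by omega⟩
  have hFq : paddedString y d g m q = y (k₀ + 1) :=
    paddedString_eq (e := e + 1) hg hk₀ (by omega) (by omega)
  have hcard : m - 2 ≤ (((Finset.Ico 1 m).erase (k₀ + 1)).image fun k => y (k + 1)).card := by
    rw [Finset.card_image_of_injOn]
    · have := Finset.pred_card_le_card_erase (s := Finset.Ico 1 m) (a := k₀ + 1)
      rw [Nat.card_Ico] at this
      omega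
    · intro k hk k' hk' h
      simp only [Finset.coe_erase, Finset.coe_Ico, Set.mem_sdiff, Set.mem_Ico] at hk hk'
      have := hy (by simpa using hk.1.2) (by simpa using hk'.1.2) h
      omega
  refine hcard.trans (card_le_ncard_symmDiff_MAW hq (by omega) ?_ _ ?_)
  · intro s h1 h2 h
    rw [hFq] at h
    have h3 := mod_eq_of_paddedString_eq hy hk₀ h
    have h4 := mod_eq_of_paddedString_eq hy hk₀ hFq
    have := Nat.eq_of_mod_eq_of_lt_add (h3.trans h4.symm) (by omega) (by omega)
    omega
  · have htail : factor (paddedString y d g m) (q + 1) j = List.replicate j (y 0) :=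
      factor_eq_replicate fun r hr =>
        paddedString_eq_zero (e := e + 1) (k := k₀) (r := r + 1) (by omega) (by omega) (by omega)
          (by omega)
    intro b hb
    obtain ⟨k, hk, rfl⟩ := Finset.mem_image.1 hb
    simp only [Finset.mem_erase, Finset.mem_Ico] at hk
    obtain ⟨hne, hk1, hkm⟩ := hk
    obtain ⟨k, rfl⟩ := Nat.exists_eq_add_of_le' hk1
    have hgk : g * (k + 1) = g * k + g := Nat.mul_succ _ _
    have hgm : g * (k + 1) + g ≤ m * g := by
      rw [← Nat.mul_succ, mul_comm]
      exact Nat.mul_le_mul_right g hkm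
    -- In the window, phases up to `φ` lie in the current period, the later ones in the previous one.
    rcases Nat.lt_or_ge k k₀ with hlt | hge
    · have hle : g * (k + 1) ≤ g * k₀ := Nat.mul_le_mul_left g hlt
      refine ⟨i + d - φ + g * (k + 1) - j, by omega, by omega, ?_, ?_⟩
      · rw [htail]
        exact factor_eq_replicate fun r hr =>
          paddedString_eq_zero (e := e + 1) (k := k) (r := g - j + r) (by omega) (by omega)
            (by omega) (by omega)
      · exact paddedString_eq (e := e + 1) hg hkm (by omega) (by omega)
    · have hle : g * (k₀ + 1) ≤ g * k := Nat.mul_le_mul_left g (by omega)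
      have hgk₀ : g * (k₀ + 1) = g * k₀ + g := Nat.mul_succ _ _
      refine ⟨i + g * (k + 1) - φ - 1 - j, by omega, by omega, ?_, ?_⟩
      · rw [htail]
        exact factor_eq_replicate fun r hr =>
          paddedString_eq_zero (e := e) (k := k) (r := g - j + r) (by omega) (by omega)
            (by omega) (by omega)
      · exact paddedString_eq (e := e) hg hkm (by omega) (by omega)

theorem exists_paddedString_eq (hg : 0 < g) (hd : 1 ≤ d) (hmd : m ≤ d) (hmg : m * g ≤ d + 1)
    {k n : ℕ} (hk : k < m + 1) (hn : d < n) : ∃ t < n, paddedString y d g m t = y k := by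
  have hgm : g * m ≤ d + 1 := by rwa [mul_comm]
  cases k with
  | zero =>
    rcases Nat.lt_or_ge 1 g with h | h
    · exact ⟨0, by omega, paddedString_eq_zero (e := 0) (k := 0) (r := 1) one_pos h (by omega)
        (by omega)⟩
    · obtain rfl : g = 1 := by omega
      refine ⟨d - 1, by omega, ?_⟩
      rw [paddedString, if_neg]
      rw [Nat.sub_add_cancel hd, Nat.mod_eq_of_lt (Nat.lt_succ_self d), Nat.div_one]
      omega
  | succ k =>
    have hgk : g * k + g ≤ g * m := by
      rw [← Nat.mul_succ]
      exact Nat.mul_le_mul_left g (by omega)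
    rcases Nat.eq_zero_or_pos k with rfl | hk0
    · exact ⟨d, hn, paddedString_eq (e := 1) hg (by omega) (by omega) (by omega)⟩
    · have := Nat.mul_pos hg hk0
      exact ⟨g * k - 1, by omega, paddedString_eq (e := 0) hg (by omega) (by omega) (by omega)⟩

end padded

/-- If a residue class condition `i % P < G` covers half of a period, it covers half of every
initial segment: `i ↦ i - G` injects its complement into it. -/
theorem le_two_mul_card_filter_mod_lt {P G : ℕ} (h : P ≤ 2 * G) (hP : 0 < P) (N : ℕ) :
    N ≤ 2 * ((Finset.range N).filter fun i => i % P < G).card := by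
  have hle : ((Finset.range N).filter fun i => ¬ i % P < G).card ≤
      ((Finset.range N).filter fun i => i % P < G).card := by
    refine Finset.card_le_card_of_injOn (· - G) ?_ ?_
    · intro i hi
      simp only [Finset.coe_filter, Finset.mem_range, Set.mem_ofPred_eq, not_lt] at hi ⊢
      refine ⟨by omega, ?_⟩
      have h1 := Nat.div_add_mod i P
      have h2 := Nat.mod_lt i hP
      have h3 : i - G = P * (i / P) + (i % P - G) := by omega
      rw [h3, Nat.mul_add_mod, Nat.mod_eq_of_lt (by omega)]
      omega
    · intro i hi i' hi' hii
      simp only [Finset.coe_filter, Finset.mem_range, Set.mem_ofPred_eq, not_lt] at hi hi'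
      have h1 := Nat.mod_le i P
      have h2 := Nat.mod_le i' P
      simp only at hii
      omega
  have := Finset.card_filter_add_card_filter_not (s := Finset.range N) fun i => i % P < G
  rw [Finset.card_range] at this
  omega

/-! ### The lower bound -/

theorem exists_enumeration (α : Type*) [Fintype α] [Nonempty α] :
    ∃ y : ℕ → α, Set.InjOn y (Set.Iio (Fintype.card α)) ∧
      ∀ a, ∃ k < Fintype.card α, y k = a := by
  have hpos : 0 < Fintype.card α := Fintype.card_pos
  refine ⟨fun k => (Fintype.equivFin α).symm ⟨k % Fintype.card α, Nat.mod_lt _ hpos⟩, ?_, ?_⟩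
  · intro k hk k' hk' h
    have := (Fintype.equivFin α).symm.injective h
    rwa [Fin.mk.injEq, Nat.mod_eq_of_lt hk, Nat.mod_eq_of_lt hk'] at this
  · intro a
    refine ⟨Fintype.equivFin α a, (Fintype.equivFin α a).2, ?_⟩
    simp [Nat.mod_eq_of_lt (Fintype.equivFin α a).2]

/-- The lower bound in integers. For at most three characters, and for more than `d`, the cyclic
string on all characters will do; otherwise the padded string. -/
theorem exists_le_totalMAWChange (α : Type*) [Fintype α] [DecidableEq α] {n d : ℕ}
    (hα : 2 ≤ Fintype.card α) (hd : 1 ≤ d) (hn : d < n) :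
    ∃ T : List α, T.length = n ∧ (Fintype.card α ≤ n → T.toFinset = Finset.univ) ∧
      (n - d) * min (Fintype.card α) d ≤ 8 * totalMAWChange T d := by
  have : Nonempty α := Fintype.card_pos_iff.1 (by omega)
  obtain ⟨y, hy, hsurj⟩ := exists_enumeration α
  generalize Fintype.card α = σ at hα hy hsurj ⊢
  by_cases hσ : σ ≤ 3 ∨ d < σ
  · refine ⟨(List.range n).map fun t => y (t % σ), by simp, fun hσn => ?_, ?_⟩
    · refine toFinset_map_range_eq_univ fun a => ?_
      obtain ⟨k, hk, rfl⟩ := hsurj a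
      exact ⟨k, by omega, by rw [Nat.mod_eq_of_lt hk]⟩
    · rw [totalMAWChange_map_range, Finset.mul_sum]
      nth_rw 1 [← Finset.card_range (n - d)]
      rw [← smul_eq_mul]
      refine Finset.card_nsmul_le_sum _ _ _ fun i _ => ?_
      rcases hσ with h | h
      · have := one_le_ncard_symmDiff_MAW_cyclic hy hd hα i
        have := min_le_left σ d
        omega
      · have := le_ncard_symmDiff_MAW_cyclic hy hd h i
        have := min_le_right σ d
        omega
  · obtain ⟨m, rfl⟩ : ∃ m, σ = m + 1 := ⟨σ - 1, by omega⟩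
    have hm : 0 < m := by omega
    have hg : 0 < (d + 1) / m := Nat.div_pos (by omega) hm
    have hmg : m * ((d + 1) / m) ≤ d + 1 := Nat.mul_div_le _ _
    have hhalf : d + 1 ≤ 2 * (m * ((d + 1) / m)) := by
      have h1 := Nat.div_add_mod (d + 1) m
      have h2 := Nat.mod_lt (d + 1) hm
      have h3 := Nat.mul_le_mul_left m hg
      omega
    generalize (d + 1) / m = g at hg hmg hhalf
    refine ⟨(List.range n).map (paddedString y d g m), by simp, fun _ => ?_, ?_⟩
    · refine toFinset_map_range_eq_univ fun a => ?_
      obtain ⟨k, hk, rfl⟩ := hsurj a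
      exact exists_paddedString_eq hg hd (by omega) hmg hk hn
    · rw [totalMAWChange_map_range]
      have h1 := le_two_mul_card_filter_mod_lt hhalf (by omega) (n - d)
      have h2 : ((Finset.range (n - d)).filter fun i => i % (d + 1) < m * g).card * (m - 2) ≤
          ∑ i ∈ Finset.range (n - d), (MAW (factor (paddedString y d g m) i d) ∆
            MAW (factor (paddedString y d g m) (i + 1) d)).ncard := by
        refine le_trans ?_ (Finset.sum_le_sum_of_subset
          (Finset.filter_subset (fun i => i % (d + 1) < m * g) _))
        refine Finset.card_nsmul_le_sum _ _ _ fun i hi => ?_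
        exact le_ncard_symmDiff_MAW_padded hy hg (by omega) hd hmg (Finset.mem_filter.1 hi).2
      have h3 : min (m + 1) d ≤ 4 * (m - 2) := (min_le_left _ _).trans (by omega)
      have h4 := Nat.mul_le_mul h1 h3
      linarith

theorem mainTheorem3 :
    -- the upper bound, in the number of distinct characters of `T`
    (∃ C : ℝ, 0 < C ∧
      ∀ (α : Type*) [Fintype α] [DecidableEq α] (T : List α) (d : ℕ),
        1 ≤ d → d < T.length →
          (totalMAWChange T d : ℝ) ≤ C * (min T.toFinset.card d : ℕ) * (T.length : ℝ)) ∧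
    -- the matching lower bound, where `n - d` is at least a constant fraction of `n`
    (∀ ε : ℝ, 0 < ε → ∃ c : ℝ, 0 < c ∧
      ∀ (α : Type*) [Fintype α] [DecidableEq α] (n d : ℕ),
        2 ≤ Fintype.card α → 1 ≤ d → d < n → ε * (n : ℝ) ≤ (n : ℝ) - (d : ℝ) →
          ∃ T : List α, T.length = n ∧ (Fintype.card α ≤ n → T.toFinset = Finset.univ) ∧
            c * (min (Fintype.card α) d : ℕ) * (n : ℝ) ≤ (totalMAWChange T d : ℝ)) := by
  refine ⟨⟨8, by norm_num, fun α _ _ T d hd hT => ?_⟩, fun ε hε => ⟨ε / 8, by positivity, ?_⟩⟩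
  · exact_mod_cast totalMAWChange_le T hd hT
  · intro α _ _ n d hα hd hn h
    obtain ⟨T, hl, hT, hle⟩ := exists_le_totalMAWChange α hα hd hn
    refine ⟨T, hl, hT, ?_⟩
    have hle' : ((n : ℝ) - d) * (min (Fintype.card α) d : ℕ) ≤ 8 * totalMAWChange T d := by
      rw [← Nat.cast_sub hn.le]
      exact_mod_cast hle
    have := mul_le_mul_of_nonneg_right h (Nat.cast_nonneg (α := ℝ) (min (Fintype.card α) d))
    linarith
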